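/- For $E\subset\mathbb{R}$ and $s>0$ let $$\mathcal{P}_0^s(E)=\lim_{\delta\to 0^+}\sup\Big\{\sum_i r_i^s\Big\},$$ where the supremum is over all collections of pairwise disjoint closed balls $B(x_i,r_i)$ with centres $x_i\in E$ and radii $0<r_i<\delta$; let $$\mathcal{P}^s(E)=\inf\Big\{\sum_{i=1}^\infty \mathcal{P}_0^s(E_i): E\subset\bigcup_{i=1}^\infty E_i\Big\},$$ and let $\dim_P(E)=\inf\{s>0:\mathcal{P}^s(E)=0\}$ be the packing dimension of $E$. **Corollary (Convex images).** Let $A\subset[0,1]$ be a Borel set with $\dim_P(A)>1/2$. Then there exists an $F_\sigma$ set $B\subset\mathbb{R}$ of Lebesgue measure zero such that $f(A)+B=\mathbb{R}$ for all strictly increasing convex functions $f:[0,1]\to\mathbb{R}$, where $f(A)+B=\{f(a)+b: a\in A,\ b\in B\}$. -/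

import Mathlib

open Set MeasureTheory
open scoped NNReal ENNReal Pointwise

/-- A `δ`-packing of `E`: a collection of pairwise disjoint closed balls with centres in `E` and
positive radii less than `δ`. A ball is recorded as the pair (centre, radius). -/
structure IsPacking {X : Type*} [MetricSpace X] (δ : ℝ≥0) (E : Set X) (P : Set (X × ℝ≥0)) :
    Prop where
  center_mem : ∀ p ∈ P, p.1 ∈ E
  radius_pos : ∀ p ∈ P, 0 < p.2
  radius_lt : ∀ p ∈ P, p.2 < δ
  disjoint : P.Pairwise fun p q =>
    Disjoint (Metric.closedBall p.1 (p.2 : ℝ)) (Metric.closedBall q.1 (q.2 : ℝ))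

/-- The packing pre-measure associated with a gauge function `φ`. The supremum is monotone in `δ`,
so the limit as `δ → 0` is the infimum over `δ > 0`. -/
noncomputable def packingPreMeasure {X : Type*} [MetricSpace X] (φ : ℝ≥0 → ℝ≥0) (E : Set X) :
    ℝ≥0∞ :=
  ⨅ (δ : ℝ≥0) (_ : 0 < δ), ⨆ (P : Set (X × ℝ≥0)) (_ : IsPacking δ E P),
    ∑' p : P, (φ p.1.2 : ℝ≥0∞)

/-- The outer packing measure associated with a gauge function `φ`. -/
noncomputable def packingMeasure {X : Type*} [MetricSpace X] (φ : ℝ≥0 → ℝ≥0) (E : Set X) :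
    ℝ≥0∞ :=
  ⨅ (F : ℕ → Set X) (_ : E ⊆ ⋃ i, F i), ∑' i, packingPreMeasure φ (F i)

/-- The packing dimension of `E`: the infimum of all `s > 0` such that the packing measure of `E`
with gauge function `r ↦ r ^ s` vanishes. -/
noncomputable def packingDim {X : Type*} [MetricSpace X] (E : Set X) : ℝ≥0∞ :=
  ⨅ (s : ℝ≥0) (_ : 0 < s) (_ : packingMeasure (fun r : ℝ≥0 => r ^ (s : ℝ)) E = 0), (s : ℝ≥0∞)

/-- An `F_σ` set: a countable union of closed sets. -/
def IsFSigma {X : Type*} [TopologicalSpace X] (B : Set X) : Prop :=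
  ∃ F : ℕ → Set X, (∀ n, IsClosed (F n)) ∧ B = ⋃ n, F n

/-! Two exponents are compared at the scale ε = 4^{-j}. Convex functions on [u,v] ⊂ (0,1) with
slopes in [m,L] and values in [-R,R] have an O(ε)-net T with log |T| = O(j 2^j)
(`exists_net_isBiLipConvex`). Packing dimension above 1/2 yields, at arbitrarily small scales, at
least q^j points of A that are ε-separated, with q > 2
(`exists_separated_of_packingPreMeasure_ne_zero`). A net function sends these points to distinct
cells of length mε, out of O(4^j) cells, so a greedy choice of about (4/q)^j log |T| cells meets
every image. Slightly enlarged, the chosen cells form a closed set of measure O(j (2/q)^j) into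
which every function of the class sends a point of A (`exists_closed_hitting`).

To reach measure zero this is iterated near the points found. The good scale depends on the place,
so each ball of a finitely branching tree is refined at its own scale. Since A is Borel, it contains
a continuous image of a complete space in which nonempty open sets have non-null images; a nested
branch converges there (`exists_null_closed_of_refinements`).

For real t, the function f - t lies in one of countably many classes. If C_n is the closed null set
of class n, then f(a) - t ∈ C_n for some a ∈ A, so B is the union of the sets -C_n. -/

/-! ### Hitting sets for families of large subsets -/

/-- Greedy hitting sets. -/
theorem exists_hitting_finset_aux {ι α : Type*} [DecidableEq α] (Ω : Finset α) (T : Finset ι)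
    (S : ι → Finset α) (hS : ∀ i ∈ T, S i ⊆ Ω) {k : ℝ} (hk : 0 < k)
    (hcard : ∀ i ∈ T, k ≤ (S i).card) (hkΩ : k ≤ Ω.card) (j : ℕ) :
    ∃ H : Finset α, H.card ≤ j ∧ ∃ T' : Finset ι, (∀ i ∈ T, i ∉ T' → (S i ∩ H).Nonempty) ∧
      T' ⊆ T ∧ (T'.card : ℝ) ≤ T.card * (1 - k / Ω.card) ^ j := by
  classical
  have hΩ : (0 : ℝ) < Ω.card := hk.trans_le hkΩ
  have hq : 0 ≤ 1 - k / Ω.card := by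
    rw [sub_nonneg, div_le_one hΩ]; exact hkΩ
  induction j with
  | zero => exact ⟨∅, by simp, T, fun i h h' => (h' h).elim, subset_rfl, by simp⟩
  | succ j ih =>
    obtain ⟨H, hH, T', hT', hsub, hle⟩ := ih
    have hsum : ∑ x ∈ Ω, ((T'.filter fun i => x ∈ S i).card : ℝ) = ∑ i ∈ T', ((S i).card : ℝ) := by
      have := Finset.sum_card_bipartiteAbove_eq_sum_card_bipartiteBelow (s := Ω) (t := T')
        (fun x i => x ∈ S i)
      simp only [Finset.bipartiteAbove, Finset.bipartiteBelow] at this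
      have h2 : ∀ i ∈ T', Ω.filter (fun x => x ∈ S i) = S i := fun i hi => by
        ext x
        simp only [Finset.mem_filter, and_iff_right_iff_imp]
        exact fun h => hS i (hsub hi) h
      rw [Finset.sum_congr rfl fun i hi => congrArg Finset.card (h2 i hi)] at this
      exact_mod_cast this
    -- Averaging over Ω: some point lies in at least a fraction k/|Ω| of the sets not yet hit.
    have hex : ∃ x ∈ Ω, k / Ω.card * T'.card ≤ ((T'.filter fun i => x ∈ S i).card : ℝ) := by
      apply Finset.exists_le_of_sum_le (Finset.card_pos.1 (by exact_mod_cast hΩ))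
      rw [hsum, Finset.sum_const, nsmul_eq_mul]
      calc (Ω.card : ℝ) * (k / Ω.card * T'.card) = T'.card * k := by field_simp
        _ ≤ ∑ i ∈ T', ((S i).card : ℝ) := by
          rw [← nsmul_eq_mul]
          exact Finset.card_nsmul_le_sum _ _ _ fun i hi => hcard i (hsub hi)
    obtain ⟨x, -, hx⟩ := hex
    refine ⟨insert x H, (Finset.card_insert_le _ _).trans (by omega),
      T'.filter fun i => x ∉ S i, fun i hi hi' => ?_, (Finset.filter_subset _ _).trans hsub, ?_⟩
    · by_cases h : i ∈ T'
      · refine ⟨x, ?_⟩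
        simp only [Finset.mem_filter, not_and, not_not] at hi'
        simp [hi' h]
      · exact (hT' i hi h).mono (Finset.inter_subset_inter_left (Finset.subset_insert _ _))
    · have := Finset.card_filter_add_card_filter_not (s := T') (fun i => x ∈ S i)
      have h3 : ((T'.filter fun i => x ∈ S i).card : ℝ) + (T'.filter fun i => x ∉ S i).card
          = T'.card := by exact_mod_cast this
      calc ((T'.filter fun i => x ∉ S i).card : ℝ) ≤ T'.card * (1 - k / Ω.card) := by
            linarith
        _ ≤ _ := by
          rw [pow_succ, ← mul_assoc]
          exact mul_le_mul_of_nonneg_right hle hq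

theorem exists_hitting_finset {ι α : Type*} [DecidableEq α] (Ω : Finset α) (T : Finset ι)
    (S : ι → Finset α) (hS : ∀ i ∈ T, S i ⊆ Ω) {k : ℝ} (hk : 0 < k)
    (hcard : ∀ i ∈ T, k ≤ (S i).card) :
    ∃ H : Finset α, (H.card : ℝ) ≤ Ω.card / k * Real.log T.card + 1 ∧
      ∀ i ∈ T, (S i ∩ H).Nonempty := by
  rcases T.eq_empty_or_nonempty with rfl | ⟨i₀, hi₀⟩
  · exact ⟨∅, by simp, by simp⟩
  have hkΩ : k ≤ Ω.card := (hcard i₀ hi₀).trans (by exact_mod_cast Finset.card_le_card (hS i₀ hi₀))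
  have hΩ : (0 : ℝ) < Ω.card := hk.trans_le hkΩ
  have hT : (1 : ℝ) ≤ T.card := by exact_mod_cast Finset.card_pos.2 ⟨i₀, hi₀⟩
  have hlog : 0 ≤ Ω.card / k * Real.log T.card :=
    mul_nonneg (by positivity) (Real.log_nonneg hT)
  -- The least number of greedy choices with |T| exp(-jk/|Ω|) < 1, which leaves no set unhit.
  set j := ⌊Ω.card / k * Real.log T.card⌋₊ + 1 with hj
  obtain ⟨H, hH, T', hT', -, hle⟩ := exists_hitting_finset_aux Ω T S hS hk hcard hkΩ j
  have hjlt : Ω.card / k * Real.log T.card < j := by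
    rw [hj]; push_cast; exact Nat.lt_floor_add_one _
  have hlt : (T'.card : ℝ) < 1 := by
    refine hle.trans_lt ?_
    have h1 : (1 - k / Ω.card) ^ j ≤ Real.exp (-(k / Ω.card)) ^ j := by
      refine pow_le_pow_left₀ ?_ ?_ _
      · rw [sub_nonneg, div_le_one hΩ]; exact hkΩ
      · linarith [Real.add_one_le_exp (-(k / Ω.card : ℝ))]
    rw [← Real.exp_nat_mul] at h1
    have h2 : Real.log T.card < j * (k / Ω.card) := by
      have := mul_lt_mul_of_pos_right hjlt (div_pos hk hΩ)
      calc _ = Ω.card / k * Real.log T.card * (k / Ω.card) := by field_simp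
        _ < _ := this
    calc (T.card : ℝ) * (1 - k / Ω.card) ^ j
        ≤ Real.exp (Real.log T.card) * Real.exp (j * -(k / Ω.card)) := by
          rw [Real.exp_log (by linarith)]
          exact mul_le_mul_of_nonneg_left h1 (by linarith)
      _ = Real.exp (Real.log T.card - j * (k / Ω.card)) := by rw [← Real.exp_add]; ring_nf
      _ < 1 := by rw [Real.exp_lt_one_iff]; linarith
  have h0 : T' = ∅ := by
    rw [← Finset.card_eq_zero]
    have : T'.card < 1 := by exact_mod_cast hlt
    omega
  refine ⟨H, ?_, fun i hi => hT' i hi (by simp [h0])⟩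
  calc (H.card : ℝ) ≤ j := by exact_mod_cast hH
    _ ≤ _ := by
      rw [hj]; push_cast
      linarith [Nat.floor_le hlog]

/-! ### Coding convex sequences -/

/-- The sequences `a 0, …, a (K ^ 2)` bounded by `R` with nondecreasing increments in `[0, D]`. -/
structure IsConvexSeq (K : ℕ) (D R : ℝ) (a : ℕ → ℝ) : Prop where
  bound : ∀ i ≤ K ^ 2, |a i| ≤ R
  nonneg : ∀ i < K ^ 2, a i ≤ a (i + 1)
  le : ∀ i < K ^ 2, a (i + 1) - a i ≤ D
  mono : ∀ i j, i ≤ j → j < K ^ 2 → a (i + 1) - a i ≤ a (j + 1) - a j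

/-- The number of increments of `a` below each of the levels `j D / K`, and the rounded values of
`a` at the multiples of `K`. -/
noncomputable def seqCode (K N : ℕ) (D : ℝ) (a : ℕ → ℝ) :
    (Fin (K + 1) → Fin (K ^ 2 + 1)) × (Fin K → Fin (2 * N + 1)) :=
  (fun j => ⟨((Finset.range (K ^ 2)).filter fun i => a (i + 1) - a i < j * (D / K)).card, by
      have := Finset.card_filter_le (Finset.range (K ^ 2))
        (fun i => a (i + 1) - a i < j * (D / K))
      rw [Finset.card_range] at this
      omega⟩,
    fun i => ⟨min (2 * N) (⌊a (i * K) / D⌋ + N).toNat, by omega⟩)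

/-- The increments are nondecreasing, so those below θ form an initial segment, determined by its
cardinality. -/
theorem IsConvexSeq.lt_level_iff {K : ℕ} {D R : ℝ} {a : ℕ → ℝ} (ha : IsConvexSeq K D R a)
    {i : ℕ} (hi : i < K ^ 2) (θ : ℝ) :
    a (i + 1) - a i < θ ↔
      i < ((Finset.range (K ^ 2)).filter fun i => a (i + 1) - a i < θ).card := by
  constructor
  · intro h
    have : Finset.range (i + 1) ⊆ (Finset.range (K ^ 2)).filter fun i => a (i + 1) - a i < θ := by
      intro l hl
      simp only [Finset.mem_range, Finset.mem_filter] at hl ⊢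
      exact ⟨by omega, (ha.mono l i (by omega) hi).trans_lt h⟩
    have := Finset.card_le_card this
    rw [Finset.card_range] at this
    omega
  · intro h
    by_contra! hθ
    have : ((Finset.range (K ^ 2)).filter fun i => a (i + 1) - a i < θ) ⊆ Finset.range i := by
      intro l hl
      simp only [Finset.mem_range, Finset.mem_filter] at hl ⊢
      by_contra! hil
      exact absurd (ha.mono i l hil hl.1) (by linarith)
    have := Finset.card_le_card this
    rw [Finset.card_range] at this
    omega

theorem increment_lt_of_seqCode_eq {K N : ℕ} {D R : ℝ} (hK : 0 < K) (hD : 0 < D)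
    {a b : ℕ → ℝ} (ha : IsConvexSeq K D R a) (hb : IsConvexSeq K D R b)
    (h : seqCode K N D a = seqCode K N D b) {i : ℕ} (hi : i < K ^ 2) :
    a (i + 1) - a i ≤ b (i + 1) - b i + D / K := by
  have hDK : 0 < D / K := by positivity
  have hd0 : 0 ≤ (a (i + 1) - a i) / (D / K) := div_nonneg (by linarith [ha.nonneg i hi]) hDK.le
  set j := ⌊(a (i + 1) - a i) / (D / K)⌋₊ with hj
  have hj1 : j * (D / K) ≤ a (i + 1) - a i := by
    have := Nat.floor_le hd0
    rwa [le_div_iff₀ hDK] at this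
  have hj2 : a (i + 1) - a i < (j + 1) * (D / K) := by
    have := Nat.lt_floor_add_one ((a (i + 1) - a i) / (D / K))
    rwa [div_lt_iff₀ hDK] at this
  have hjK : j < K + 1 := by
    have h1 : (j : ℝ) * (D / K) ≤ K * (D / K) := by
      calc _ ≤ a (i + 1) - a i := hj1
        _ ≤ D := ha.le i hi
        _ = _ := by field_simp
    have : (j : ℝ) ≤ K := le_of_mul_le_mul_right h1 hDK
    have : j ≤ K := by exact_mod_cast this
    omega
  have hc := congrArg Fin.val (congrFun (congrArg Prod.fst h) ⟨j, hjK⟩)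
  simp only [seqCode] at hc
  have h3 : ¬ b (i + 1) - b i < j * (D / K) := by
    rw [hb.lt_level_iff hi, ← hc, ← ha.lt_level_iff hi]
    exact not_lt.2 hj1
  linarith [not_lt.1 h3]

/-- Equal codes give values within D at the multiples of K. Increments differ by at most D/K, so
over a block of K steps the error grows by at most another D. -/
theorem abs_sub_le_of_seqCode_eq {K N : ℕ} {D R : ℝ} (hK : 0 < K) (hD : 0 < D) (hN : R / D ≤ N)
    {a b : ℕ → ℝ} (ha : IsConvexSeq K D R a) (hb : IsConvexSeq K D R b)
    (h : seqCode K N D a = seqCode K N D b) {i : ℕ} (hi : i ≤ K ^ 2) :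
    |a i - b i| ≤ 2 * D := by
  have hDK : 0 < D / K := by positivity
  -- The truncations in `seqCode` are inactive: they do not alter the rounded values.
  have hfl : ∀ c : ℕ → ℝ, IsConvexSeq K D R c → ∀ l < K,
      0 ≤ ⌊c (l * K) / D⌋ + N ∧ ⌊c (l * K) / D⌋ + N ≤ 2 * N := by
    intro c hc l hl
    have h1 := abs_le.1 (hc.bound (l * K) (by rw [pow_two]; exact Nat.mul_le_mul_right K hl.le))
    have hND : R ≤ N * D := by rwa [div_le_iff₀ hD] at hN
    constructor
    · have : (-N : ℤ) ≤ ⌊c (l * K) / D⌋ := by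
        rw [Int.le_floor, le_div_iff₀ hD]; push_cast; linarith
      linarith
    · have h2 : (⌊c (l * K) / D⌋ : ℝ) ≤ N := by
        refine (Int.floor_le _).trans ?_
        rw [div_le_iff₀ hD]; linarith
      have : ⌊c (l * K) / D⌋ ≤ N := by exact_mod_cast h2
      linarith
  have hval : ∀ l < K, |a (l * K) - b (l * K)| ≤ D := by
    intro l hl
    have hc := congrArg Fin.val (congrFun (congrArg Prod.snd h) ⟨l, hl⟩)
    simp only [seqCode] at hc
    have h1 := hfl a ha l hl
    have h2 := hfl b hb l hl
    have h3 : ⌊a (l * K) / D⌋ = ⌊b (l * K) / D⌋ := by omega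
    have h4 := Int.abs_sub_lt_one_of_floor_eq_floor h3
    rw [← sub_div, abs_div, abs_of_pos hD, div_lt_one hD] at h4
    exact h4.le
  have hstep : ∀ l < K, ∀ t ≤ K, |a (l * K + t) - b (l * K + t)| ≤ D + t * (D / K) := by
    intro l hl t
    induction t with
    | zero => intro _; simpa using hval l hl
    | succ t ih =>
      intro ht
      have h0 := ih (by omega)
      have hlt : l * K + t < K ^ 2 := by nlinarith
      have h1 := increment_lt_of_seqCode_eq hK hD ha hb h hlt
      have h2 := increment_lt_of_seqCode_eq hK hD hb ha h.symm hlt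
      rw [abs_le] at h0 ⊢
      push_cast
      rw [← add_assoc]
      constructor <;> linarith
  -- Only blocks l < K are coded, so the endpoint K² is step t = K of the last block.
  obtain ⟨l, t, hl, ht, rfl⟩ : ∃ l t, l < K ∧ t ≤ K ∧ i = l * K + t := by
    rcases hi.lt_or_eq with hi | rfl
    · exact ⟨i / K, i % K, Nat.div_lt_of_lt_mul (by rwa [← pow_two]), (Nat.mod_lt _ hK).le,
        (Nat.div_add_mod' i K).symm⟩
    · refine ⟨K - 1, K, by omega, le_rfl, ?_⟩
      obtain ⟨k, rfl⟩ : ∃ k, K = k + 1 := ⟨K - 1, by omega⟩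
      simp; ring
  refine (hstep l hl t ht).trans ?_
  have : (t : ℝ) * (D / K) ≤ K * (D / K) :=
    mul_le_mul_of_nonneg_right (by exact_mod_cast ht) hDK.le
  have h2 : K * (D / K) = D := by field_simp
  linarith

/-! ### Packing measures and separated points -/

theorem IsPacking.radius_lt_dist {X : Type*} [MetricSpace X] {δ : ℝ≥0} {E : Set X}
    {P : Set (X × ℝ≥0)} (hP : IsPacking δ E P) {p p' : X × ℝ≥0} (hp : p ∈ P) (hp' : p' ∈ P)
    (hne : p ≠ p') : (p.2 : ℝ) < dist p.1 p'.1 := by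
  by_contra! h
  exact Set.disjoint_left.1 (hP.disjoint hp hp' hne)
    (Metric.mem_closedBall.2 ((dist_comm _ _).trans_le h))
    (Metric.mem_closedBall_self (NNReal.coe_nonneg _))

/-- Centres of disjoint balls of radius above 4^{-(n+1)} are that far apart, so there are at most C
such balls. -/
theorem IsPacking.tsum_le_of_card_le {X : Type*} [MetricSpace X] {δ : ℝ≥0} {E : Set X}
    {P : Set (X × ℝ≥0)} (hP : IsPacking δ E P) {s : ℝ} (hs : 0 ≤ s) {n : ℕ} {C : ℝ≥0}
    (hC : ∀ Y : Finset X, (↑Y ⊆ E) →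
      (∀ x ∈ Y, ∀ y ∈ Y, x ≠ y → (1 / 4 : ℝ) ^ (n + 1) ≤ dist x y) → (Y.card : ℝ≥0) ≤ C) :
    ∑' p : {p ∈ P | (1 / 4 : ℝ≥0) ^ (n + 1) < p.2 ∧ p.2 ≤ (1 / 4) ^ n},
      ((p.1.2 ^ s : ℝ≥0) : ℝ≥0∞) ≤ C * (((1 / 4) ^ s : ℝ≥0) : ℝ≥0∞) ^ n := by
  classical
  rw [ENNReal.tsum_eq_iSup_sum]
  refine iSup_le fun T => ?_
  have hsep : ∀ p ∈ T, ∀ p' ∈ T, p ≠ p' → (1 / 4 : ℝ) ^ (n + 1) < dist p.1.1 p'.1.1 := by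
    intro p _ p' _ hne
    have h1 : (1 / 4 : ℝ) ^ (n + 1) < p.1.2 := by exact_mod_cast p.2.2.1
    exact h1.trans (hP.radius_lt_dist p.2.1 p'.2.1 (fun h => hne (Subtype.ext h)))
  have hinj : Set.InjOn (fun p : {p ∈ P | (1 / 4 : ℝ≥0) ^ (n + 1) < p.2 ∧ p.2 ≤ (1 / 4) ^ n} =>
      p.1.1) T := by
    intro p hp p' hp' h
    by_contra hne
    have := hsep p hp p' hp' hne
    simp only at h
    rw [h, dist_self] at this
    exact absurd this (not_lt.2 (by positivity))
  have hcard := hC (T.image fun p => p.1.1) (by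
      intro x hx
      simp only [Finset.coe_image, Set.mem_image] at hx
      obtain ⟨p, -, rfl⟩ := hx
      exact hP.center_mem _ p.2.1) (by
      intro x hx y hy hxy
      obtain ⟨p, hp, rfl⟩ := Finset.mem_image.1 hx
      obtain ⟨p', hp', rfl⟩ := Finset.mem_image.1 hy
      exact (hsep p hp p' hp' (fun h => hxy (by rw [h]))).le)
  rw [Finset.card_image_of_injOn hinj] at hcard
  calc ∑ p ∈ T, ((p.1.2 ^ s : ℝ≥0) : ℝ≥0∞) ≤ ∑ p ∈ T, (((1 / 4) ^ s : ℝ≥0) : ℝ≥0∞) ^ n := by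
        refine Finset.sum_le_sum fun p _ => ?_
        have hpow : ((1 / 4 : ℝ≥0) ^ s) ^ n = ((1 / 4 : ℝ≥0) ^ n) ^ s := by
          rw [← NNReal.rpow_natCast, ← NNReal.rpow_mul, mul_comm, NNReal.rpow_mul,
            NNReal.rpow_natCast]
        rw [← ENNReal.coe_pow, ENNReal.coe_le_coe, hpow]
        exact NNReal.rpow_le_rpow p.2.2.2 hs
    _ ≤ _ := by
      rw [Finset.sum_const, nsmul_eq_mul]
      gcongr
      exact_mod_cast hcard

/-- A set of positive packing pre-measure contains many separated points at arbitrarily small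
scales. -/
theorem exists_separated_of_packingPreMeasure_ne_zero {X : Type*} [MetricSpace X] {E : Set X}
    {s : ℝ} (hs : 0 ≤ s) {q : ℝ≥0} (hq : q * (1 / 4) ^ s < 1)
    (hE : packingPreMeasure (fun r : ℝ≥0 => r ^ s) E ≠ 0) (j₀ : ℕ) :
    ∃ j ≥ j₀, ∃ Y : Finset X, ↑Y ⊆ E ∧ (q : ℝ) ^ j ≤ Y.card ∧
      ∀ x ∈ Y, ∀ y ∈ Y, x ≠ y → (1 / 4 : ℝ) ^ j ≤ dist x y := by
  by_contra! hcon
  apply hE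
  -- Were separated sets always smaller than q^j, balls of radius about 4^{-n} would contribute at
  -- most q^{n+1} 4^{-sn}: the tail of a geometric series of ratio ρ < 1.
  set ρ : ℝ≥0 := q * (1 / 4) ^ s with hρ
  have hbound : ∀ j₁ ≥ j₀, packingPreMeasure (fun r : ℝ≥0 => r ^ s) E ≤
      (ρ : ℝ≥0∞) ^ j₁ * (q * (1 - (ρ : ℝ≥0∞))⁻¹) := by
    intro j₁ hj₁
    refine (iInf₂_le ((1 / 4 : ℝ≥0) ^ j₁) (by positivity)).trans (iSup₂_le fun P hP => ?_)
    have hcover : P ⊆ ⋃ n : ℕ,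
        {p ∈ P | (1 / 4 : ℝ≥0) ^ (n + j₁ + 1) < p.2 ∧ p.2 ≤ (1 / 4) ^ (n + j₁)} := by
      intro p hp
      have hlt := hP.radius_lt p hp
      have hq1 : (1 / 4 : ℝ≥0) < 1 := by
        rw [← NNReal.coe_lt_coe]; norm_num
      obtain ⟨n, hn1, hn2⟩ := exists_nat_pow_near_of_lt_one (hP.radius_pos p hp)
        (hlt.le.trans (pow_le_one₀ (by positivity) hq1.le)) (by positivity : (0 : ℝ≥0) < 1 / 4) hq1
      have hn : j₁ ≤ n := by
        have := (pow_lt_pow_iff_right_of_lt_one₀ (by positivity) hq1).1 (hn1.trans hlt)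
        omega
      refine Set.mem_iUnion.2 ⟨n - j₁, ?_⟩
      rw [Nat.sub_add_cancel hn]
      exact ⟨hp, hn1, hn2⟩
    calc ∑' p : P, ((p.1.2 ^ s : ℝ≥0) : ℝ≥0∞)
        ≤ ∑' p : ⋃ n : ℕ, {p ∈ P | (1 / 4 : ℝ≥0) ^ (n + j₁ + 1) < p.2 ∧ p.2 ≤ (1 / 4) ^ (n + j₁)},
          ((p.1.2 ^ s : ℝ≥0) : ℝ≥0∞) :=
          ENNReal.tsum_mono_subtype (fun p : X × ℝ≥0 => ((p.2 ^ s : ℝ≥0) : ℝ≥0∞)) hcover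
      _ ≤ ∑' n : ℕ, ∑' p : {p ∈ P | (1 / 4 : ℝ≥0) ^ (n + j₁ + 1) < p.2 ∧
            p.2 ≤ (1 / 4) ^ (n + j₁)}, ((p.1.2 ^ s : ℝ≥0) : ℝ≥0∞) :=
          ENNReal.tsum_iUnion_le_tsum (fun p : X × ℝ≥0 => ((p.2 ^ s : ℝ≥0) : ℝ≥0∞)) _
      _ ≤ ∑' n : ℕ, ((q ^ (n + j₁ + 1) : ℝ≥0) : ℝ≥0∞) *
            (((1 / 4) ^ s : ℝ≥0) : ℝ≥0∞) ^ (n + j₁) := by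
          refine ENNReal.tsum_le_tsum fun n => hP.tsum_le_of_card_le hs fun Y hY hsep => ?_
          by_contra! hlt
          obtain ⟨x, hx, y, hy, hne, hd⟩ := hcon (n + j₁ + 1) (by omega) Y hY
            (by exact_mod_cast hlt.le)
          exact absurd (hsep x hx y hy hne) (not_le.2 hd)
      _ = ∑' n : ℕ, (ρ : ℝ≥0∞) ^ j₁ * (q * (ρ : ℝ≥0∞) ^ n) := by
          refine tsum_congr fun n => ?_
          rw [hρ]; push_cast; ring
      _ = _ := by rw [ENNReal.tsum_mul_left, ENNReal.tsum_mul_left, ENNReal.tsum_geometric]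
  have hρ1 : (ρ : ℝ≥0∞) < 1 := by exact_mod_cast hq
  have hlim : Filter.Tendsto (fun j => (ρ : ℝ≥0∞) ^ j * (q * (1 - (ρ : ℝ≥0∞))⁻¹)) Filter.atTop
      (nhds (0 * (q * (1 - (ρ : ℝ≥0∞))⁻¹))) := by
    refine ENNReal.Tendsto.mul_const (ENNReal.tendsto_pow_atTop_nhds_zero_of_lt_one hρ1) (Or.inr ?_)
    refine ENNReal.mul_ne_top ENNReal.coe_ne_top (ENNReal.inv_ne_top.2 ?_)
    exact (tsub_pos_of_lt hρ1).ne'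
  rw [zero_mul] at hlim
  exact le_antisymm (ge_of_tendsto hlim (Filter.eventually_atTop.2 ⟨j₀, hbound⟩)) bot_le

theorem packingPreMeasure_empty {X : Type*} [MetricSpace X] (φ : ℝ≥0 → ℝ≥0) :
    packingPreMeasure φ (∅ : Set X) = 0 := by
  refine le_antisymm ((iInf₂_le 1 one_pos).trans (iSup₂_le fun P hP => ?_)) bot_le
  have : P = ∅ := Set.eq_empty_of_forall_notMem fun p hp => hP.center_mem p hp
  subst this
  simp

/-- The packing measure as an outer measure. -/
noncomputable def packingOuterMeasure {X : Type*} [MetricSpace X] (φ : ℝ≥0 → ℝ≥0) :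
    OuterMeasure X :=
  OuterMeasure.ofFunction (packingPreMeasure φ) (packingPreMeasure_empty φ)

theorem packingOuterMeasure_apply {X : Type*} [MetricSpace X] (φ : ℝ≥0 → ℝ≥0) (E : Set X) :
    packingOuterMeasure φ E = packingMeasure φ E :=
  OuterMeasure.ofFunction_apply _ _ _

theorem exists_packingMeasure_ne_zero_of_lt_packingDim {X : Type*} [MetricSpace X] {E : Set X}
    {d : ℝ≥0} (h : d < packingDim E) :
    ∃ s : ℝ≥0, d < s ∧ packingMeasure (fun r : ℝ≥0 => r ^ (s : ℝ)) E ≠ 0 := by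
  obtain ⟨s, hs1, hs2⟩ := ENNReal.lt_iff_exists_nnreal_btwn.1 h
  have hds : d < s := by exact_mod_cast hs1
  refine ⟨s, hds, fun h0 => absurd hs2 (not_lt.2 ?_)⟩
  exact iInf_le_of_le s (iInf₂_le (bot_le.trans_lt hds) h0)

/-! ### Complete parametrization of analytic sets -/

/-- An analytic set that is not null for an outer measure is, up to a null set, the image of a
complete metric space in which the images of nonempty open sets are not null. -/
theorem MeasureTheory.AnalyticSet.exists_complete_parametrization {X : Type*} [TopologicalSpace X]
    {A : Set X} (hA : AnalyticSet A) (μ : OuterMeasure X) (hμ : μ A ≠ 0) :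
    ∃ (β : Type) (_ : MetricSpace β) (_ : CompleteSpace β) (g : β → X), Continuous g ∧
      Nonempty β ∧ range g ⊆ A ∧ ∀ U : Set β, IsOpen U → U.Nonempty → μ (g '' U) ≠ 0 := by
  obtain ⟨γ, _, _, g, hg, rfl⟩ := analyticSet_iff_exists_polishSpace_range.1 hA
  let := TopologicalSpace.upgradeIsCompletelyMetrizable γ
  -- Removing the countably many basic open sets with null image loses only a null set.
  set I := {U ∈ TopologicalSpace.countableBasis γ | μ (g '' U) = 0} with hI
  have hIc : I.Countable := (TopologicalSpace.countable_countableBasis γ).mono (sep_subset _ _)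
  set O := ⋃ U ∈ I, U with hO
  have hOo : IsOpen O := isOpen_biUnion fun U hU => TopologicalSpace.isOpen_of_mem_countableBasis hU.1
  have hOμ : μ (g '' O) = 0 := by
    rw [hO, image_iUnion₂]
    exact (measure_biUnion_null_iff hIc).2 fun U hU => hU.2
  refine ⟨(Oᶜ : Set γ), inferInstance, hOo.isClosed_compl.completeSpace_coe, fun p => g p,
    hg.comp continuous_subtype_val, ?_, ?_, ?_⟩
  · by_contra hne
    rw [Set.nonempty_coe_sort, Set.not_nonempty_iff_eq_empty, Set.compl_empty_iff] at hne
    rw [hne, image_univ] at hOμ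
    exact hμ hOμ
  · rintro _ ⟨p, rfl⟩
    exact mem_range_self _
  · rintro U hU ⟨p, hp⟩ h0
    obtain ⟨V, hV, rfl⟩ := isOpen_induced_iff.1 hU
    obtain ⟨W, hW, hpW, hWV⟩ := (TopologicalSpace.isBasis_countableBasis γ).exists_subset_of_mem_open
      hp hV
    have hW0 : μ (g '' W) = 0 := by
      refine measure_mono_null ?_ (measure_union_null h0 hOμ)
      rintro _ ⟨w, hw, rfl⟩
      by_cases hwO : w ∈ O
      · exact Or.inr (mem_image_of_mem _ hwO)
      · exact Or.inl ⟨⟨w, hwO⟩, hWV hw, rfl⟩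
    exact p.2 (mem_iUnion₂.2 ⟨W, ⟨hW, hW0⟩, hpW⟩)

/-! ### Metric entropy of convex functions -/

/-- Convex functions on `[u, v]` bounded by `R` whose slopes lie in `[m, L]`. -/
structure IsBiLipConvex (u v m L R : ℝ) (h : ℝ → ℝ) : Prop where
  lower : ∀ x ∈ Icc u v, ∀ y ∈ Icc u v, x ≤ y → m * (y - x) ≤ h y - h x
  upper : ∀ x ∈ Icc u v, ∀ y ∈ Icc u v, x ≤ y → h y - h x ≤ L * (y - x)
  bound : ∀ x ∈ Icc u v, |h x| ≤ R
  convex : ConvexOn ℝ (Icc u v) h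

theorem IsBiLipConvex.abs_sub_le {u v m L R : ℝ} {h : ℝ → ℝ} (hh : IsBiLipConvex u v m L R h)
    (hm : 0 ≤ m) {x y : ℝ} (hx : x ∈ Icc u v) (hy : y ∈ Icc u v) : |h x - h y| ≤ L * |x - y| := by
  rcases le_total x y with hxy | hxy
  · have h1 := hh.lower x hx y hy hxy
    have h2 := hh.upper x hx y hy hxy
    have h3 := mul_nonneg hm (sub_nonneg.2 hxy)
    rw [abs_sub_comm, abs_sub_comm x, abs_of_nonneg (by linarith), abs_of_nonneg (by linarith)]
    exact h2
  · have h1 := hh.lower y hy x hx hxy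
    have h2 := hh.upper y hy x hx hxy
    have h3 := mul_nonneg hm (sub_nonneg.2 hxy)
    rw [abs_of_nonneg (by linarith), abs_of_nonneg (by linarith)]
    exact h2

theorem IsBiLipConvex.le_abs_sub {u v m L R : ℝ} {h : ℝ → ℝ} (hh : IsBiLipConvex u v m L R h)
    {x y : ℝ} (hx : x ∈ Icc u v) (hy : y ∈ Icc u v) : m * |x - y| ≤ |h x - h y| := by
  rcases le_total x y with hxy | hxy
  · rw [abs_sub_comm, abs_sub_comm (h x), abs_of_nonneg (sub_nonneg.2 hxy)]
    exact (hh.lower x hx y hy hxy).trans (le_abs_self _)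
  · rw [abs_of_nonneg (sub_nonneg.2 hxy)]
    exact (hh.lower y hy x hx hxy).trans (le_abs_self _)

theorem mem_Icc_of_grid {u v : ℝ} (huv : u < v) {n i : ℕ} (hn : 0 < n) (hi : i ≤ n) :
    u + i * ((v - u) / n) ∈ Icc u v := by
  have hn' : (0 : ℝ) < n := by exact_mod_cast hn
  have h0 : 0 ≤ (v - u) / n := div_nonneg (by linarith) hn'.le
  have h1 : i * ((v - u) / n) ≤ n * ((v - u) / n) :=
    mul_le_mul_of_nonneg_right (by exact_mod_cast hi) h0
  have h2 : n * ((v - u) / n) = v - u := by field_simp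
  have h3 : 0 ≤ i * ((v - u) / n) := by positivity
  constructor <;> linarith

theorem IsBiLipConvex.isConvexSeq {u v m L R : ℝ} {h : ℝ → ℝ} (hh : IsBiLipConvex u v m L R h)
    (hm : 0 ≤ m) (hL : 0 ≤ L) (huv : u < v) (hw : v - u ≤ 1) {K : ℕ} (hK : 0 < K) :
    IsConvexSeq K (L / (K ^ 2 : ℕ)) R fun i => h (u + i * ((v - u) / (K ^ 2 : ℕ))) := by
  have hn : 0 < K ^ 2 := by positivity
  have hn' : (0 : ℝ) < (K ^ 2 : ℕ) := by exact_mod_cast hn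
  have hd : 0 < (v - u) / (K ^ 2 : ℕ) := div_pos (by linarith) hn'
  have hsucc : ∀ i : ℕ, u + ((i + 1 : ℕ) : ℝ) * ((v - u) / (K ^ 2 : ℕ)) =
      u + i * ((v - u) / (K ^ 2 : ℕ)) + (v - u) / (K ^ 2 : ℕ) := fun i => by push_cast; ring
  have hmem : ∀ i ≤ K ^ 2, u + i * ((v - u) / (K ^ 2 : ℕ)) ∈ Icc u v := fun i hi =>
    mem_Icc_of_grid huv hn hi
  refine ⟨fun i hi => hh.bound _ (hmem i hi), fun i hi => ?_, fun i hi => ?_, ?_⟩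
  · have := hh.lower _ (hmem i hi.le) _ (hmem (i + 1) hi) (by rw [hsucc]; linarith)
    rw [hsucc] at this
    rw [hsucc]
    have h2 := mul_nonneg hm hd.le
    linarith
  · have := hh.upper _ (hmem i hi.le) _ (hmem (i + 1) hi) (by rw [hsucc]; linarith)
    rw [hsucc] at this
    rw [hsucc]
    refine this.trans ?_
    rw [add_sub_cancel_left, ← mul_div_assoc]
    gcongr
    nlinarith
  · intro i j hij
    induction j, hij using Nat.le_induction with
    | base => exact fun _ => le_rfl
    | succ j hij ih =>
      intro hj
      refine (ih (by omega)).trans ?_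
      have h1 := hh.convex.slope_mono_adjacent (hmem j (by omega)) (hmem (j + 1 + 1) (by omega))
        (y := u + ((j + 1 : ℕ) : ℝ) * ((v - u) / (K ^ 2 : ℕ)))
        (by rw [hsucc]; linarith) (by rw [hsucc (j + 1)]; linarith)
      have e1 : u + ((j + 1 : ℕ) : ℝ) * ((v - u) / (K ^ 2 : ℕ)) -
        (u + j * ((v - u) / (K ^ 2 : ℕ))) = (v - u) / (K ^ 2 : ℕ) := by rw [hsucc]; ring
      have e2 : u + ((j + 1 + 1 : ℕ) : ℝ) * ((v - u) / (K ^ 2 : ℕ)) -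
        (u + ((j + 1 : ℕ) : ℝ) * ((v - u) / (K ^ 2 : ℕ))) = (v - u) / (K ^ 2 : ℕ) := by
        rw [hsucc (j + 1)]; ring
      rw [e1, e2] at h1
      exact (div_le_div_iff_of_pos_right hd).1 h1

theorem Set.exists_finset_representatives {α ι : Type*} [Fintype ι] (F : Set α) (c : α → ι) :
    ∃ T : Finset α, ↑T ⊆ F ∧ T.card ≤ Fintype.card ι ∧ ∀ h ∈ F, ∃ h₀ ∈ T, c h = c h₀ := by
  classical
  obtain ⟨s, hsF, hs⟩ := (surjOn_image c F).exists_bijOn_subset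
  have hfin : s.Finite := hs.finite_iff_finite.2 (toFinite _)
  refine ⟨hfin.toFinset, by simpa using hsF, ?_, fun h hh => ?_⟩
  · rw [← Finset.card_image_of_injOn (f := c) (by simpa using hs.injOn)]
    exact Finset.card_le_univ _
  · obtain ⟨h₀, hh₀, he⟩ := hs.surjOn (mem_image_of_mem c hh)
    exact ⟨h₀, by simpa using hh₀, he.symm⟩

/-- With K = 2^j a code has about 2K entries, each with O(4^j) values. The exponent 1/2 arises here:
a grid of 4^j steps costs only O(j 2^j). -/
theorem log_card_seqCode_le {R L : ℝ} (hR : 0 ≤ R) (hL : 0 < L) (j : ℕ) :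
    Real.log (Fintype.card ((Fin (2 ^ j + 1) → Fin ((2 ^ j) ^ 2 + 1)) ×
      (Fin (2 ^ j) → Fin (2 * ⌈R / (L / ((2 ^ j) ^ 2 : ℕ))⌉₊ + 1)))) ≤
      (6 + Real.log (2 * R / L + 3)) * (j + 1) * 2 ^ j := by
  simp only [Fintype.card_prod, Fintype.card_fun, Fintype.card_fin]
  set N := ⌈R / (L / ((2 ^ j) ^ 2 : ℕ))⌉₊ with hN
  have h4 : ((2 : ℝ) ^ j) ^ 2 = 4 ^ j := by rw [← pow_mul, mul_comm, pow_mul]; norm_num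
  have h41 : (1 : ℝ) ≤ 4 ^ j := one_le_pow₀ (by norm_num)
  have h21 : (1 : ℝ) ≤ 2 ^ j := one_le_pow₀ (by norm_num)
  have hlog4 : Real.log 4 ≤ 2 := by
    have : (4 : ℝ) = 2 * 2 := by norm_num
    rw [this, Real.log_mul (by norm_num) (by norm_num)]
    linarith [Real.log_two_lt_d9]
  have hc : 0 ≤ Real.log (2 * R / L + 3) :=
    Real.log_nonneg (by have : 0 ≤ 2 * R / L := by positivity
                        linarith)
  push_cast
  rw [Real.log_mul (by positivity) (by positivity), Real.log_pow, Real.log_pow, h4]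
  have hA : Real.log (4 ^ j + 1) ≤ 2 * (j + 1) := by
    calc Real.log (4 ^ j + 1) ≤ Real.log (4 ^ (j + 1)) := by
          apply Real.log_le_log (by positivity)
          rw [pow_succ]; linarith
      _ = (j + 1) * Real.log 4 := by rw [Real.log_pow]; push_cast; ring
      _ ≤ (j + 1) * 2 := by gcongr
      _ = _ := by ring
  have hNle : (N : ℝ) ≤ R / L * 4 ^ j + 1 := by
    have : (N : ℝ) < R / (L / ((2 ^ j) ^ 2 : ℕ)) + 1 := Nat.ceil_lt_add_one (by positivity)
    push_cast at this
    rw [h4] at this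
    have e : R / (L / 4 ^ j) = R / L * 4 ^ j := by field_simp
    linarith
  have hB : Real.log (2 * N + 1) ≤ (2 + Real.log (2 * R / L + 3)) * (j + 1) := by
    calc Real.log (2 * N + 1) ≤ Real.log ((2 * R / L + 3) * 4 ^ j) := by
          apply Real.log_le_log (by positivity)
          have e : (2 * R / L + 3) * 4 ^ j = 2 * (R / L * 4 ^ j) + 3 * 4 ^ j := by ring
          rw [e]; linarith
      _ = Real.log (2 * R / L + 3) + j * Real.log 4 := by
          rw [Real.log_mul (by positivity) (by positivity), Real.log_pow]
      _ ≤ Real.log (2 * R / L + 3) + j * 2 := by gcongr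
      _ ≤ _ := by
          have : 0 ≤ Real.log (2 * R / L + 3) * j := by positivity
          linarith
  push_cast
  calc (2 ^ j + 1) * Real.log (4 ^ j + 1) + 2 ^ j * Real.log (2 * N + 1)
      ≤ (2 * 2 ^ j) * (2 * (j + 1)) + 2 ^ j * ((2 + Real.log (2 * R / L + 3)) * (j + 1)) := by
        have : 0 ≤ Real.log ((4 : ℝ) ^ j + 1) := Real.log_nonneg (by linarith)
        gcongr
        linarith
    _ = _ := by ring

/-- The metric entropy of convex functions. -/
theorem exists_net_isBiLipConvex {u v m L R : ℝ} (hm : 0 ≤ m) (hL : 0 < L) (hR : 0 ≤ R)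
    (huv : u < v) (hw : v - u ≤ 1) (j : ℕ) :
    ∃ T : Finset (ℝ → ℝ), (∀ h ∈ T, IsBiLipConvex u v m L R h) ∧
      Real.log T.card ≤ (6 + Real.log (2 * R / L + 3)) * (j + 1) * 2 ^ j ∧
      ∀ h, IsBiLipConvex u v m L R h → ∃ h₀ ∈ T, ∀ x ∈ Icc u v,
        |h x - h₀ x| ≤ 4 * (L * (1 / 4) ^ j) := by
  set K := 2 ^ j with hK
  have hK0 : 0 < K := by positivity
  have hn : 0 < K ^ 2 := by positivity
  have hn' : (0 : ℝ) < (K ^ 2 : ℕ) := by exact_mod_cast hn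
  set D := L / (K ^ 2 : ℕ) with hD
  have hD0 : 0 < D := div_pos hL hn'
  have hDe : D = L * (1 / 4) ^ j := by
    rw [hD, hK, one_div_pow, ← div_eq_mul_one_div]
    congr 1
    push_cast
    rw [← pow_mul, mul_comm, pow_mul]; norm_num
  set δ := (v - u) / (K ^ 2 : ℕ) with hδ
  have hδ0 : 0 < δ := div_pos (by linarith) hn'
  have hLδ : L * δ ≤ D := by
    rw [hδ, hD, ← mul_div_assoc]
    gcongr
    nlinarith
  obtain ⟨T, hTF, hTc, hT⟩ := Set.exists_finset_representatives {h | IsBiLipConvex u v m L R h}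
    (fun h => seqCode K ⌈R / D⌉₊ D fun i => h (u + i * δ))
  refine ⟨T, hTF, ?_, fun h hh => ?_⟩
  · refine le_trans ?_ (log_card_seqCode_le hR hL j)
    -- If T is empty, the convention `Real.log 0 = 0` applies.
    rcases T.card.eq_zero_or_pos with h0 | h0
    · rw [h0, Nat.cast_zero, Real.log_zero]
      exact Real.log_natCast_nonneg _
    · exact Real.log_le_log (by exact_mod_cast h0) (by exact_mod_cast hTc)
  · obtain ⟨h₀, hh₀, hc⟩ := hT h hh
    have hh₀' : IsBiLipConvex u v m L R h₀ := hTF hh₀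
    refine ⟨h₀, hh₀, fun x hx => ?_⟩
    have hx0 : 0 ≤ (x - u) / δ := div_nonneg (by linarith [hx.1]) hδ0.le
    set i := ⌊(x - u) / δ⌋₊ with hi
    have hi1 : i * δ ≤ x - u := by
      have := Nat.floor_le hx0
      rwa [le_div_iff₀ hδ0] at this
    have hi2 : x - u < (i + 1) * δ := by
      have := Nat.lt_floor_add_one ((x - u) / δ)
      rwa [div_lt_iff₀ hδ0] at this
    have hiK : i ≤ K ^ 2 := by
      have h1 : (i : ℝ) * δ ≤ (K ^ 2 : ℕ) * δ := by
        have : ((K ^ 2 : ℕ) : ℝ) * δ = v - u := by rw [hδ]; field_simp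
        linarith [hx.2]
      exact_mod_cast le_of_mul_le_mul_right h1 hδ0
    -- The error 4D is 2D at the grid point left of x, plus D for each of the two functions in
    -- moving from x to it.
    have hxi : |x - (u + i * δ)| ≤ δ := by rw [abs_le]; constructor <;> linarith
    have hmem : u + i * δ ∈ Icc u v := mem_Icc_of_grid huv hn hiK
    have h1 := hh.abs_sub_le hm hx hmem
    have h2 := hh₀'.abs_sub_le hm hx hmem
    have h3 := abs_sub_le_of_seqCode_eq hK0 hD0 (Nat.le_ceil (R / D))
      (hh.isConvexSeq hm hL.le huv hw hK0) (hh₀'.isConvexSeq hm hL.le huv hw hK0) hc hiK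
    have h4 : L * |x - (u + i * δ)| ≤ D := (mul_le_mul_of_nonneg_left hxi hL.le).trans hLδ
    rw [← hDe]
    simp only [abs_le] at h1 h2 h3 ⊢
    constructor <;> linarith

/-! ### Small closed sets met by all images -/

theorem exists_closed_hitting {u v m L R : ℝ} (hm : 0 < m) (hL : 0 < L) (hR : 0 ≤ R)
    (huv : u < v) (hw : v - u ≤ 1) {q : ℝ} (hq : 0 < q) (j : ℕ) {X : Finset ℝ}
    (hX : ↑X ⊆ Icc u v) (hcard : q ^ j ≤ X.card)
    (hsep : ∀ x ∈ X, ∀ y ∈ X, x ≠ y → (1 / 4 : ℝ) ^ j ≤ dist x y) :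
    ∃ C : Set ℝ, IsClosed C ∧
      volume C ≤ ENNReal.ofReal ((m + 10 * L) * ((2 * R / m + 3) *
        (6 + Real.log (2 * R / L + 3)) * ((j + 1) * (2 / q) ^ j) + (1 / 4) ^ j)) ∧
      ∀ h, IsBiLipConvex u v m L R h → ∃ x ∈ X, ∀ y ∈ Icc u v,
        |y - x| ≤ (1 / 4) ^ j → h y ∈ C := by
  classical
  obtain ⟨T, hTF, hTlog, hT⟩ := exists_net_isBiLipConvex hm.le hL hR huv hw j
  set ε : ℝ := (1 / 4) ^ j with hε
  have hε0 : 0 < ε := by positivity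
  have hε1 : ε ≤ 1 := pow_le_one₀ (by norm_num) (by norm_num)
  -- Slopes are at least m, so ε-separated points have images at least `lam` apart, in distinct
  -- cells.
  set lam := m * ε with hlam
  have hlam0 : 0 < lam := by positivity
  set M := ⌈R / lam⌉₊ with hM
  have hRM : R ≤ M * lam := by
    have := Nat.le_ceil (R / lam)
    rwa [div_le_iff₀ hlam0] at this
  obtain ⟨H, hHcard, hH⟩ := exists_hitting_finset (Finset.Icc (-M : ℤ) M) T
    (fun h => X.image fun x => ⌊h x / lam⌋) (k := q ^ j) (by
      intro h hh c hc
      obtain ⟨x, hx, rfl⟩ := Finset.mem_image.1 hc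
      have hb := abs_le.1 ((hTF h hh).bound x (hX hx))
      rw [Finset.mem_Icc]
      constructor
      · rw [Int.le_floor, le_div_iff₀ hlam0]; push_cast; linarith
      · have h2 : (⌊h x / lam⌋ : ℝ) ≤ M := by
          refine (Int.floor_le _).trans ?_
          rw [div_le_iff₀ hlam0]; linarith
        exact_mod_cast h2) (by positivity) (by
      intro h hh
      rw [Finset.card_image_of_injOn]
      · exact hcard
      · intro x hx y hy hxy
        by_contra hne
        have h1 := Int.abs_sub_lt_one_of_floor_eq_floor hxy
        rw [← sub_div, abs_div, abs_of_pos hlam0, div_lt_one hlam0] at h1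
        have h2 := (hTF h hh).le_abs_sub (hX hx) (hX hy)
        have h3 := mul_le_mul_of_nonneg_left (hsep x hx y hy hne) hm.le
        rw [Real.dist_eq] at h3
        linarith)
  set D := L * ε with hD
  -- The margin 5D is 4D for replacing h by a net function plus D for moving from x to y.
  refine ⟨⋃ c ∈ H, Icc (c * lam - 5 * D) (c * lam + lam + 5 * D),
    H.finite_toSet.isClosed_biUnion fun c _ => isClosed_Icc, ?_, fun h hh => ?_⟩
  · calc volume (⋃ c ∈ H, Icc (c * lam - 5 * D) (c * lam + lam + 5 * D))
        ≤ ∑ c ∈ H, volume (Icc (c * lam - 5 * D) (c * lam + lam + 5 * D)) :=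
          measure_biUnion_finset_le _ _
      _ = ∑ c ∈ H, ENNReal.ofReal ((m + 10 * L) * ε) := by
          refine Finset.sum_congr rfl fun c _ => ?_
          rw [Real.volume_Icc]
          congr 1
          rw [hD, hlam]; ring
      _ = ENNReal.ofReal (H.card * ((m + 10 * L) * ε)) := by
          rw [Finset.sum_const, nsmul_eq_mul, ENNReal.ofReal_mul (Nat.cast_nonneg H.card),
            ENNReal.ofReal_natCast]
      _ ≤ _ := by
          apply ENNReal.ofReal_le_ofReal
          set C₀ := 6 + Real.log (2 * R / L + 3) with hC₀
          have hΩ : ε * ((Finset.Icc (-M : ℤ) M).card : ℝ) ≤ 2 * R / m + 3 := by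
            have e1 : (Finset.Icc (-M : ℤ) M).card = 2 * M + 1 := by
              rw [Int.card_Icc]; omega
            have hMle : (M : ℝ) < R / lam + 1 := Nat.ceil_lt_add_one (by positivity)
            rw [e1]; push_cast
            calc ε * (2 * M + 1) ≤ ε * (2 * (R / lam + 1) + 1) := by gcongr
              _ = 2 * R / m + 3 * ε := by rw [hlam]; field_simp; ring
              _ ≤ _ := by linarith
          have hlog0 : 0 ≤ Real.log T.card := Real.log_natCast_nonneg _
          calc (H.card : ℝ) * ((m + 10 * L) * ε)
              ≤ ((Finset.Icc (-M : ℤ) M).card / q ^ j * Real.log T.card + 1) *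
                ((m + 10 * L) * ε) := by gcongr
            _ = (m + 10 * L) * (ε * ((Finset.Icc (-M : ℤ) M).card : ℝ) *
                (Real.log T.card / q ^ j) + ε) := by ring
            _ ≤ (m + 10 * L) * ((2 * R / m + 3) * (C₀ * (j + 1) * 2 ^ j / q ^ j) + ε) := by
                gcongr
            _ = _ := by rw [div_pow]; ring
  · obtain ⟨h₀, hh₀, hclose⟩ := hT h hh
    obtain ⟨c, hc⟩ := hH h₀ hh₀
    obtain ⟨hc1, hcH⟩ := Finset.mem_inter.1 hc
    obtain ⟨x, hx, rfl⟩ := Finset.mem_image.1 hc1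
    refine ⟨x, hx, fun y hy hyx => mem_biUnion hcH ?_⟩
    have h1 := hclose x (hX hx)
    have h2 := hh.abs_sub_le hm.le hy (hX hx)
    have h3 : L * |y - x| ≤ D := mul_le_mul_of_nonneg_left hyx hL.le
    have h4 := Int.floor_le (h₀ x / lam)
    have h5 := Int.lt_floor_add_one (h₀ x / lam)
    rw [le_div_iff₀ hlam0] at h4
    rw [div_lt_iff₀ hlam0] at h5
    simp only [abs_le] at h1 h2
    constructor <;> linarith

theorem eventually_scale_bound_le {q : ℝ} (hq : 2 < q) (a b : ℝ) {η : ℝ} (hη : 0 < η) :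
    ∀ᶠ j : ℕ in Filter.atTop, a * (b * (((j : ℝ) + 1) * (2 / q) ^ j) + (1 / 4) ^ j) ≤ η := by
  have h0 : 0 ≤ 2 / q := by positivity
  have h1 : 2 / q < 1 := by rw [div_lt_one (by linarith)]; exact hq
  have t1 := (tendsto_self_mul_const_pow_of_lt_one h0 h1).add
    (tendsto_pow_atTop_nhds_zero_of_lt_one h0 h1)
  have t2 := tendsto_pow_atTop_nhds_zero_of_lt_one (by norm_num : (0 : ℝ) ≤ 1 / 4) (by norm_num)
  have t3 := ((t1.const_mul b).add t2).const_mul a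
  simp only [add_zero, mul_zero] at t3
  filter_upwards [t3.eventually_le_const hη] with j hj
  rwa [add_mul, one_mul]

/-- Any q strictly between 2 and 4^s: the points then outnumber the entropy 2^j exponentially. -/
theorem exists_rate_of_half_lt {s : ℝ} (hs : 1 / 2 < s) :
    ∃ q : ℝ≥0, 2 < (q : ℝ) ∧ q * (1 / 4 : ℝ≥0) ^ s < 1 := by
  have h4 : (2 : ℝ≥0) < 4 ^ s := by
    have e : (2 : ℝ≥0) = 4 ^ (1 / 2 : ℝ) := by
      have : (4 : ℝ≥0) = 2 ^ (2 : ℝ) := by norm_num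
      rw [this, ← NNReal.rpow_mul]; norm_num
    calc (2 : ℝ≥0) = 4 ^ (1 / 2 : ℝ) := e
      _ < 4 ^ s := NNReal.rpow_lt_rpow_of_exponent_lt (by norm_num) hs
  obtain ⟨q, hq1, hq2⟩ := exists_between h4
  refine ⟨q, by exact_mod_cast hq1, ?_⟩
  rw [one_div, NNReal.inv_rpow, ← div_eq_mul_inv, div_lt_one (by positivity)]
  exact hq2

/-! ### Refinement trees and null closed sets -/

/-- The closed set `C` and the finite set `W` of balls refine the ball with centre `p.1` and radius
`p.2`: the image under `g` of one of the balls is mapped into `C` by each function of the class. -/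
theorem exists_refinement_of_ball {β : Type*} [MetricSpace β] {g : β → ℝ} (hg : Continuous g)
    {s : ℝ} (hs : 1 / 2 < s) (hpos : ∀ U : Set β, IsOpen U → U.Nonempty →
      packingPreMeasure (fun r : ℝ≥0 => r ^ s) (g '' U) ≠ 0)
    {u v m L R : ℝ} (hm : 0 < m) (hL : 0 < L) (hR : 0 ≤ R) (huv : u < v) (hw : v - u ≤ 1)
    {p : β × ℝ} (hr : 0 < p.2) (hsub : g '' Metric.ball p.1 p.2 ⊆ Icc u v) {η : ℝ} (hη : 0 < η) :
    ∃ (W : Finset (β × ℝ)) (C : Set ℝ), IsClosed C ∧ volume C ≤ ENNReal.ofReal η ∧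
      (∀ w ∈ W, 0 < w.2 ∧ w.2 ≤ η) ∧
      ∀ h, IsBiLipConvex u v m L R h → ∃ w ∈ W,
        Metric.closedBall w.1 w.2 ⊆ Metric.ball p.1 p.2 ∧
        ∀ y ∈ Metric.closedBall w.1 w.2, h (g y) ∈ C := by
  classical
  obtain ⟨q, hq2, hqs⟩ := exists_rate_of_half_lt hs
  obtain ⟨j₀, hj₀⟩ := Filter.eventually_atTop.1 (eventually_scale_bound_le hq2 (m + 10 * L)
    ((2 * R / m + 3) * (6 + Real.log (2 * R / L + 3))) hη)
  -- The scale j depends on the ball p; only its being at least j₀ is controlled.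
  obtain ⟨j, hj, X, hXsub, hcard, hsep⟩ := exists_separated_of_packingPreMeasure_ne_zero
    (by linarith) hqs (hpos _ Metric.isOpen_ball ⟨p.1, Metric.mem_ball_self hr⟩) j₀
  obtain ⟨C, hC, hCvol, hCh⟩ := exists_closed_hitting hm hL hR huv hw (by linarith) j
    (hXsub.trans hsub) hcard hsep
  have hball : ∀ x : ℝ, ∃ w : β × ℝ, x ∈ X → (0 < w.2 ∧ w.2 ≤ η) ∧
      Metric.closedBall w.1 w.2 ⊆ Metric.ball p.1 p.2 ∧
      ∀ y ∈ Metric.closedBall w.1 w.2, |g y - x| ≤ (1 / 4) ^ j := by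
    intro x
    by_cases hx : x ∈ X
    · obtain ⟨y, hy, rfl⟩ := hXsub hx
      have hnhds : Metric.ball p.1 p.2 ∩ g ⁻¹' Metric.ball (g y) ((1 / 4) ^ j) ∈ nhds y :=
        Filter.inter_mem (Metric.isOpen_ball.mem_nhds hy)
          (hg.continuousAt.preimage_mem_nhds (Metric.ball_mem_nhds _ (by positivity)))
      obtain ⟨ρ, hρ, hρsub⟩ := Metric.nhds_basis_closedBall.mem_iff.1 hnhds
      have hmono : Metric.closedBall y (min ρ η) ⊆ Metric.closedBall y ρ :=
        Metric.closedBall_subset_closedBall (min_le_left _ _)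
      refine ⟨(y, min ρ η), fun _ => ⟨⟨lt_min hρ hη, min_le_right _ _⟩,
        fun z hz => (hρsub (hmono hz)).1, fun z hz => ?_⟩⟩
      exact (Metric.mem_ball.1 (hρsub (hmono hz)).2).le
    · exact ⟨p, fun h => (hx h).elim⟩
  choose w hw' using hball
  refine ⟨X.image w, C, hC, hCvol.trans (ENNReal.ofReal_le_ofReal (hj₀ j hj)), ?_, fun h hh => ?_⟩
  · intro z hz
    obtain ⟨x, hx, rfl⟩ := Finset.mem_image.1 hz
    exact (hw' x hx).1
  · obtain ⟨x, hx, hxC⟩ := hCh h hh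
    refine ⟨w x, Finset.mem_image_of_mem _ hx, (hw' x hx).2.1, fun y hy => hxC _ ?_
      ((hw' x hx).2.2 y hy)⟩
    exact hsub (mem_image_of_mem g ((hw' x hx).2.1 hy))

/-- The measure budget is halved for each further ball. Only the ball chosen for h is known to lie
inside its parent, so Q discards members of T that cannot be refined. -/
theorem exists_refinement_of_finset {β : Type*} [MetricSpace β] {g : β → ℝ} {H : Set (ℝ → ℝ)}
    {Q : β × ℝ → Prop} (hstep : ∀ p, Q p → ∀ η : ℝ, 0 < η →
      ∃ (W : Finset (β × ℝ)) (C : Set ℝ), IsClosed C ∧ volume C ≤ ENNReal.ofReal η ∧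
        (∀ w ∈ W, 0 < w.2 ∧ w.2 ≤ η) ∧
        ∀ h ∈ H, ∃ w ∈ W, Metric.closedBall w.1 w.2 ⊆ Metric.ball p.1 p.2 ∧
          ∀ y ∈ Metric.closedBall w.1 w.2, h (g y) ∈ C)
    (T : Finset (β × ℝ)) {η : ℝ} (hη : 0 < η) :
    ∃ (W : Finset (β × ℝ)) (C : Set ℝ), IsClosed C ∧ volume C ≤ ENNReal.ofReal η ∧
      (∀ w ∈ W, 0 < w.2 ∧ w.2 ≤ η) ∧
      ∀ p ∈ T, Q p → ∀ h ∈ H, ∃ w ∈ W, Metric.closedBall w.1 w.2 ⊆ Metric.ball p.1 p.2 ∧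
        ∀ y ∈ Metric.closedBall w.1 w.2, h (g y) ∈ C := by
  classical
  induction T using Finset.induction_on generalizing η with
  | empty => exact ⟨∅, ∅, isClosed_empty, by simp, by simp, by simp⟩
  | insert p T _ ih =>
    by_cases hp : Q p
    swap
    · obtain ⟨W, C, h1, h2, h3, h4⟩ := ih hη
      refine ⟨W, C, h1, h2, h3, fun p' hp' hQ => ?_⟩
      rcases Finset.mem_insert.1 hp' with rfl | hp'
      · exact (hp hQ).elim
      · exact h4 p' hp' hQ
    obtain ⟨W, C, h1, h2, h3, h4⟩ := ih (half_pos hη)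
    obtain ⟨W', C', h1', h2', h3', h4'⟩ := hstep p hp _ (half_pos hη)
    refine ⟨W ∪ W', C ∪ C', h1.union h1', ?_, fun w hw => ?_, fun p' hp' hQ h hh => ?_⟩
    · calc volume (C ∪ C') ≤ ENNReal.ofReal (η / 2) + ENNReal.ofReal (η / 2) :=
            (measure_union_le _ _).trans (add_le_add h2 h2')
        _ = ENNReal.ofReal η := by
            rw [← ENNReal.ofReal_add (half_pos hη).le (half_pos hη).le, add_halves]
    · rcases Finset.mem_union.1 hw with hw | hw
      · exact ⟨(h3 w hw).1, (h3 w hw).2.trans (half_le_self hη.le)⟩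
      · exact ⟨(h3' w hw).1, (h3' w hw).2.trans (half_le_self hη.le)⟩
    · rcases Finset.mem_insert.1 hp' with rfl | hp'
      · obtain ⟨w, hw, hs, hC⟩ := h4' h hh
        exact ⟨w, Finset.mem_union_right _ hw, hs, fun y hy => Or.inr (hC y hy)⟩
      · obtain ⟨w, hw, hs, hC⟩ := h4 p' hp' hQ h hh
        exact ⟨w, Finset.mem_union_left _ hw, hs, fun y hy => Or.inl (hC y hy)⟩

theorem exists_mem_closedBalls {β : Type*} [MetricSpace β] [CompleteSpace β] {w : ℕ → β × ℝ}
    (hpos : ∀ n, 0 < (w n).2) (hlim : Filter.Tendsto (fun n => (w n).2) Filter.atTop (nhds 0))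
    (hsub : ∀ n, Metric.closedBall (w (n + 1)).1 (w (n + 1)).2 ⊆ Metric.ball (w n).1 (w n).2) :
    ∃ y, ∀ n, y ∈ Metric.closedBall (w n).1 (w n).2 := by
  have hanti : Antitone fun n => Metric.closedBall (w n).1 (w n).2 :=
    antitone_nat_of_succ_le fun n => (hsub n).trans Metric.ball_subset_closedBall
  obtain ⟨y, hy⟩ := Metric.nonempty_iInter_of_nonempty_biInter
    (s := fun n => Metric.closedBall (w n).1 (w n).2) (fun n => Metric.isClosed_closedBall)
    (fun n => Metric.isBounded_closedBall)
    (fun N => ⟨(w N).1, mem_iInter₂.2 fun n hn =>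
      hanti hn (Metric.mem_closedBall_self (hpos N).le)⟩)
    (squeeze_zero (fun n => Metric.diam_nonneg)
      (fun n => Metric.diam_closedBall (hpos n).le) (by simpa using hlim.const_mul 2))
  exact ⟨y, mem_iInter.1 hy⟩

/-- The levels of the tree and their closed sets are fixed before h; each h then selects its own
branch, whose limit point is mapped into all of them. -/
theorem exists_null_closed_of_refinements {β : Type*} [MetricSpace β] [CompleteSpace β]
    {g : β → ℝ} {H : Set (ℝ → ℝ)} {p₀ : β × ℝ} (hp₀ : 0 < p₀.2)
    (hstep : ∀ p : β × ℝ, 0 < p.2 → Metric.ball p.1 p.2 ⊆ Metric.ball p₀.1 p₀.2 →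
      ∀ η : ℝ, 0 < η →
      ∃ (W : Finset (β × ℝ)) (C : Set ℝ), IsClosed C ∧ volume C ≤ ENNReal.ofReal η ∧
        (∀ w ∈ W, 0 < w.2 ∧ w.2 ≤ η) ∧
        ∀ h ∈ H, ∃ w ∈ W, Metric.closedBall w.1 w.2 ⊆ Metric.ball p.1 p.2 ∧
          ∀ y ∈ Metric.closedBall w.1 w.2, h (g y) ∈ C) :
    ∃ C : Set ℝ, IsClosed C ∧ volume C = 0 ∧ ∀ h ∈ H, ∃ y, h (g y) ∈ C := by
  have hη : ∀ n : ℕ, 0 < (1 / 2 : ℝ) ^ n := fun n => by positivity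
  choose W C hC hCvol hW hnext using fun (T : Finset (β × ℝ)) (n : ℕ) =>
    exists_refinement_of_finset (H := H) (g := g)
      (Q := fun p => 0 < p.2 ∧ Metric.ball p.1 p.2 ⊆ Metric.ball p₀.1 p₀.2)
      (fun p hp => hstep p hp.1 hp.2) T (hη n)
  let T : ℕ → Finset (β × ℝ) := fun n => Nat.rec {p₀} (fun n T => W T n) n
  have hlim0 : Filter.Tendsto (fun n : ℕ => (1 / 2 : ℝ) ^ n) Filter.atTop (nhds 0) :=
    tendsto_pow_atTop_nhds_zero_of_lt_one (by norm_num) (by norm_num)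
  refine ⟨⋂ n, C (T n) n, isClosed_iInter fun n => hC _ _, ?_, fun h hh => ?_⟩
  · have hle : ∀ n, volume (⋂ n, C (T n) n) ≤ ENNReal.ofReal ((1 / 2) ^ n) := fun n =>
      (measure_mono (iInter_subset _ n)).trans (hCvol _ _)
    have hlim := ENNReal.tendsto_ofReal hlim0
    rw [ENNReal.ofReal_zero] at hlim
    exact le_antisymm (ge_of_tendsto' hlim hle) bot_le
  · choose! nxt hnxtW hnxtsub hnxtC using fun n p (hp : p ∈ T n ∧ 0 < p.2 ∧
      Metric.ball p.1 p.2 ⊆ Metric.ball p₀.1 p₀.2) => hnext (T n) n p hp.1 hp.2 h hh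
    let w : ℕ → β × ℝ := fun n => Nat.rec p₀ (fun n p => nxt n p) n
    have hinv : ∀ n, w n ∈ T n ∧ 0 < (w n).2 ∧
        Metric.ball (w n).1 (w n).2 ⊆ Metric.ball p₀.1 p₀.2 := by
      intro n
      induction n with
      | zero => exact ⟨Finset.mem_singleton_self _, hp₀, subset_rfl⟩
      | succ n ih =>
        exact ⟨hnxtW n _ ih, (hW (T n) n _ (hnxtW n _ ih)).1,
          Metric.ball_subset_closedBall.trans ((hnxtsub n _ ih).trans ih.2.2)⟩
    have hlim : Filter.Tendsto (fun n => (w n).2) Filter.atTop (nhds 0) := by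
      rw [← Filter.tendsto_add_atTop_iff_nat 1]
      exact squeeze_zero (fun n => (hinv (n + 1)).2.1.le)
        (fun n => (hW (T n) n _ (hnxtW n _ (hinv n))).2) hlim0
    obtain ⟨y, hy⟩ := exists_mem_closedBalls (fun n => (hinv n).2.1) hlim
      (fun n => hnxtsub n _ (hinv n))
    exact ⟨y, mem_iInter.2 fun n => hnxtC n _ (hinv n) y (hy (n + 1))⟩

/-! ### Reduction to countably many classes -/

/-- By convexity, slopes on [u,v] are bounded below using chords from 0 and above using chords to 1.
This needs [u,v] in the open interval. A single n serves for all the bounds. -/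
theorem StrictMonoOn.exists_isBiLipConvex_sub {f : ℝ → ℝ} (hf : StrictMonoOn f (Icc 0 1))
    (hc : ConvexOn ℝ (Icc (0 : ℝ) 1) f) {u v : ℝ} (hu : 0 < u) (huv : u < v) (hv : v < 1) (t : ℝ) :
    ∃ n : ℕ, IsBiLipConvex u v (1 / (n + 1)) (n + 1) (n + 1) fun x => f x - t := by
  have h0 : (0 : ℝ) ∈ Icc (0 : ℝ) 1 := by simp
  have h1 : (1 : ℝ) ∈ Icc (0 : ℝ) 1 := by simp
  have hsub : Icc u v ⊆ Icc 0 1 := Icc_subset_Icc hu.le hv.le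
  have hu' : u ∈ Icc u v := ⟨le_rfl, huv.le⟩
  have hm : 0 < f u - f 0 := sub_pos.2 (hf h0 (hsub hu') hu)
  have hlow : ∀ x ∈ Icc u v, ∀ y ∈ Icc u v, x < y → (f u - f 0) * (y - x) ≤ f y - f x := by
    intro x hx y hy hxy
    have hs := hc.slope_mono_adjacent h0 (hsub hy) (hu.trans_le hx.1) hxy
    rw [sub_zero] at hs
    have hx0 : 0 < x := hu.trans_le hx.1
    have hfx : f u ≤ f x := hf.monotoneOn (hsub hu') (hsub hx) hx.1
    have h2 : f u - f 0 ≤ (f x - f 0) / x := by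
      rw [le_div_iff₀ hx0]
      nlinarith [(hsub hx).2]
    have h3 := h2.trans hs
    rwa [le_div_iff₀ (by linarith)] at h3
  have hup : ∀ x ∈ Icc u v, ∀ y ∈ Icc u v, x < y →
      f y - f x ≤ (f 1 - f 0) / (1 - v) * (y - x) := by
    intro x hx y hy hxy
    have hs := hc.slope_mono_adjacent (hsub hx) h1 hxy (hy.2.trans_lt hv)
    have hfy : f 0 ≤ f y := hf.monotoneOn h0 (hsub hy) (hsub hy).1
    have hf1 : f 0 ≤ f 1 := hf.monotoneOn h0 h1 zero_le_one
    have h2 : (f 1 - f y) / (1 - y) ≤ (f 1 - f 0) / (1 - v) :=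
      div_le_div₀ (by linarith) (by linarith) (by linarith) (by linarith [hy.2])
    have h3 := hs.trans h2
    rwa [div_le_iff₀ (by linarith)] at h3
  have hbd : ∀ x ∈ Icc u v, |f x - t| ≤ |f 0| + |f 1| + |t| := by
    intro x hx
    have h2 : f 0 ≤ f x := hf.monotoneOn h0 (hsub hx) (hsub hx).1
    have h3 : f x ≤ f 1 := hf.monotoneOn (hsub hx) h1 (hsub hx).2
    rw [abs_le]
    constructor <;>
      linarith [neg_abs_le (f 0), le_abs_self (f 1), neg_abs_le t, le_abs_self t, abs_nonneg (f 0),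
        abs_nonneg (f 1)]
  obtain ⟨n, hn⟩ := exists_nat_ge
    (max (1 / (f u - f 0)) (max ((f 1 - f 0) / (1 - v)) (|f 0| + |f 1| + |t|)))
  obtain ⟨hn1, hn2⟩ := max_le_iff.1 hn
  obtain ⟨hn2, hn3⟩ := max_le_iff.1 hn2
  have hn0 : (0 : ℝ) < n + 1 := by positivity
  have hmn : 1 / ((n : ℝ) + 1) ≤ f u - f 0 := by
    rw [one_div_le hn0 hm]; linarith
  refine ⟨n, fun x hx y hy hxy => ?_, fun x hx y hy hxy => ?_, fun x hx => ?_, ?_⟩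
  · rcases hxy.eq_or_lt with rfl | hxy
    · simp
    · have := mul_le_mul_of_nonneg_right hmn (sub_nonneg.2 hxy.le)
      linarith [hlow x hx y hy hxy]
  · rcases hxy.eq_or_lt with rfl | hxy
    · simp
    · have h2 : (f 1 - f 0) / (1 - v) ≤ n + 1 := by linarith
      have := mul_le_mul_of_nonneg_right h2 (sub_nonneg.2 hxy.le)
      linarith [hup x hx y hy hxy]
  · linarith [hbd x hx]
  · exact (hc.subset hsub (convex_Icc u v)).sub (concaveOn_const t (convex_Icc u v))

/-- Otherwise E ⊆ {0,1}, which cannot contain q^j ≥ q² > 4 points. -/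
theorem exists_mem_Ioo_of_packingPreMeasure_ne_zero {E : Set ℝ} (hE : E ⊆ Icc 0 1) {s : ℝ}
    (hs : 1 / 2 < s) (h : packingPreMeasure (fun r : ℝ≥0 => r ^ s) E ≠ 0) :
    ∃ x ∈ E, x ∈ Ioo (0 : ℝ) 1 := by
  obtain ⟨q, hq2, hqs⟩ := exists_rate_of_half_lt hs
  obtain ⟨j, hj, Y, hYE, hcard, -⟩ :=
    exists_separated_of_packingPreMeasure_ne_zero (by linarith) hqs h 2
  by_contra! hcon
  have hsub : Y ⊆ {0, 1} := by
    intro x hx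
    have h1 := hE (hYE hx)
    have h2 := hcon x (hYE hx)
    simp only [mem_Ioo, not_and, not_lt] at h2
    simp only [Finset.mem_insert, Finset.mem_singleton]
    rcases h1.1.eq_or_lt with h0 | h0
    · exact Or.inl h0.symm
    · exact Or.inr (le_antisymm h1.2 (h2 h0))
  have h2 : (Y.card : ℝ) ≤ 2 := by exact_mod_cast (Finset.card_le_card hsub).trans Finset.card_le_two
  have h3 : (q : ℝ) ^ 2 ≤ q ^ j := pow_le_pow_right₀ (by linarith) hj
  nlinarith

theorem mainTheorem6 (A : Set ℝ) (hA : MeasurableSet A) (hA01 : A ⊆ Icc (0 : ℝ) 1)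
    (hdim : 1 / 2 < packingDim A) :
    ∃ B : Set ℝ, IsFSigma B ∧ volume B = 0 ∧
      ∀ f : ℝ → ℝ, StrictMonoOn f (Icc (0 : ℝ) 1) → ConvexOn ℝ (Icc (0 : ℝ) 1) f →
        f '' A + B = univ := by
  obtain ⟨s, hs, hsA⟩ := exists_packingMeasure_ne_zero_of_lt_packingDim (d := 1 / 2) (E := A)
    (by rwa [ENNReal.coe_div two_ne_zero, ENNReal.coe_one, ENNReal.coe_ofNat])
  have hs' : (1 / 2 : ℝ) < (s : ℝ) := by exact_mod_cast hs
  obtain ⟨β, _, _, g, hg, ⟨b₀⟩, hgA, hgU⟩ := hA.analyticSet.exists_complete_parametrization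
    (packingOuterMeasure fun r : ℝ≥0 => r ^ (s : ℝ)) (by rwa [packingOuterMeasure_apply])
  -- The outer measure is at most the pre-measure, so its being nonzero passes to the pre-measure.
  have hpos : ∀ U : Set β, IsOpen U → U.Nonempty →
      packingPreMeasure (fun r : ℝ≥0 => r ^ (s : ℝ)) (g '' U) ≠ 0 := fun U hU hne h0 =>
    hgU U hU hne (le_antisymm ((OuterMeasure.ofFunction_le _).trans_eq h0) bot_le)
  obtain ⟨_, ⟨b, -, rfl⟩, hb⟩ := exists_mem_Ioo_of_packingPreMeasure_ne_zero (E := g '' univ)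
    (by rw [image_univ]; exact hgA.trans hA01) hs' (hpos univ isOpen_univ ⟨b₀, mem_univ _⟩)
  obtain ⟨u, hu0, hub⟩ := exists_between hb.1
  obtain ⟨v, hbv, hv1⟩ := exists_between hb.2
  have huv : u < v := hub.trans hbv
  obtain ⟨r, hr, hrsub⟩ := Metric.mem_nhds_iff.1
    (hg.continuousAt.preimage_mem_nhds (Icc_mem_nhds hub hbv) : g ⁻¹' Icc u v ∈ nhds b)
  have hC : ∀ n : ℕ, ∃ C : Set ℝ, IsClosed C ∧ volume C = 0 ∧
      ∀ h ∈ {h | IsBiLipConvex u v (1 / (n + 1)) (n + 1) (n + 1) h}, ∃ y, h (g y) ∈ C := by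
    intro n
    refine exists_null_closed_of_refinements (p₀ := (b, r)) hr fun p hp hsub η hη => ?_
    exact exists_refinement_of_ball hg hs' hpos (by positivity) (by positivity) (by positivity)
      huv (by linarith) hp (image_subset_iff.2 (hsub.trans hrsub)) hη
  choose C hCc hC0 hCh using hC
  refine ⟨⋃ n, -C n, ⟨fun n => -C n, fun n => (hCc n).neg, rfl⟩, ?_, fun f hf hc => ?_⟩
  · exact measure_iUnion_null fun n => by rw [Measure.measure_neg, hC0]
  · refine eq_univ_of_forall fun t => ?_
    obtain ⟨n, hn⟩ := hf.exists_isBiLipConvex_sub hc hu0 huv hv1 t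
    obtain ⟨y, hy⟩ := hCh n _ hn
    refine mem_add.2 ⟨f (g y), mem_image_of_mem f (hgA (mem_range_self y)), t - f (g y),
      mem_iUnion.2 ⟨n, ?_⟩, by ring⟩
    rw [mem_neg, neg_sub]
    exact hy
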